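/- Let $X\subset\mathbb{R}^d$ (Euclidean norm) satisfy $X\subset\overline{\operatorname{int}X}$, and let $A:=\overline{\mathbb{R}^d\setminus X}$ be its closed complement. For $S\subset\mathbb{R}^d$ let $d_S(y)=\inf_{s\in S}\|y-s\|$; the reach of $S$ is the supremum of all $t\ge 0$ such that every $y$ with $d_S(y)<t$ has a unique closest point in $S$. Write $\operatorname{Cone}B=\{\lambda b : \lambda\ge 0,\ b\in B\}$ and $B^{\mathrm{o}}=\{u : \langle u,b\rangle\le 0\ \ \forall b\in B\}$. The tangent cone $\operatorname{Tan}(A,x)$ is the cone generated by the limits of $(x_n-x)/\|x_n-x\|$ over sequences $x_n\in A\setminus\{x\}$ with $x_n\to x$. Suppose that $A$ has positive reach and is fully dimensional, i.e. for every $y\in\partial A$ the linear span of $\operatorname{Tan}(A,y)$ is $\mathbb{R}^d$. Let $x\in\partial A$. Define the normal cone of $X$ at $x$ by $\operatorname{Nor}(X,x):=-\operatorname{Nor}(A,x)$, where $\operatorname{Nor}(A,x)=\operatorname{Tan}(A,x)^{\mathrm{o}}$, and let $\partial^* d_X(x)$ denote the Clarke gradient of $d_X$ at $x$, i.e. the convex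 hull of all limits $\lim_i\nabla d_X(x_i)$ with $x_i\to x$ and $d_X$ differentiable at every $x_i$. Then $$\operatorname{Nor}(X,x)=\operatorname{Cone}\bigl(\partial^* d_X(x)\bigr).$$ -/

import Mathlib

open Filter Topology
open scoped Pointwise ENNReal

noncomputable section

namespace NormalClarke

variable {E : Type*} [NormedAddCommGroup E] [InnerProductSpace ℝ E]

/-- The closed complement of `X`: the closure of the set-theoretic complement. -/
def closedCompl (X : Set E) : Set E := closure Xᶜ

/-- The cone generated by `B`: the image of `[0, ∞) × B` under scalar multiplication. -/
def coneHull (B : Set E) : Set E := {v | ∃ t : ℝ, 0 ≤ t ∧ ∃ b ∈ B, v = t • b}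

/-- The polar (dual) cone of `B`: all `u` with `⟪u, b⟫ ≤ 0` for every `b ∈ B`. -/
def polarCone (B : Set E) : Set E := {u | ∀ b ∈ B, inner ℝ u b ≤ 0}

/-- The reach of `A`: the largest `t ∈ [0, ∞]` such that every point at distance less than `t`
from `A` has a unique closest point in `A`. -/
def reach (A : Set E) : ℝ≥0∞ :=
  sSup {t | ∀ y : E, Metric.infEDist y A < t → ∃! a, a ∈ A ∧ dist y a = Metric.infDist y A}

/-- The tangent cone of `A` at `x`: the cone generated by the limits of
`(y n - x) / ‖y n - x‖`, for sequences `y` in `A \ {x}` converging to `x`. -/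
def tangentCone (A : Set E) (x : E) : Set E :=
  coneHull {u | ∃ y : ℕ → E, (∀ n, y n ∈ A ∧ y n ≠ x) ∧ Tendsto y atTop (𝓝 x) ∧
    Tendsto (fun n => ‖y n - x‖⁻¹ • (y n - x)) atTop (𝓝 u)}

/-- The normal cone at `x` of a set `A` of positive reach: the polar of the tangent cone. -/
def normalCone (A : Set E) (x : E) : Set E := polarCone (tangentCone A x)

/-- The normal cone at `x` of a set `X` whose closed complement has positive reach and is fully
dimensional: the opposite of the normal cone of the closed complement. -/
def normalConeOfCompl (X : Set E) (x : E) : Set E := -normalCone (closedCompl X) x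

/-- `A` is fully dimensional: at each boundary point its tangent cone has the dimension of the
ambient space, the dimension of a cone being that of its linear span. -/
def FullyDimensional (A : Set E) : Prop :=
  ∀ x ∈ frontier A,
    Module.finrank ℝ (Submodule.span ℝ (tangentCone A x)) = Module.finrank ℝ E

/-- The Clarke gradient of `f` at `x`: the convex hull of all limits of gradients of `f` along
sequences of differentiability points of `f` converging to `x`. -/
def clarkeGradient [CompleteSpace E] (f : E → ℝ) (x : E) : Set E :=
  convexHull ℝ {v | ∃ y : ℕ → E, (∀ n, DifferentiableAt ℝ f (y n)) ∧ Tendsto y atTop (𝓝 x) ∧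
    Tendsto (fun n => gradient f (y n)) atTop (𝓝 v)}

end NormalClarke

end

open Filter Topology
open scoped Pointwise ENNReal

noncomputable section

namespace NormalClarke

variable {E : Type*} [NormedAddCommGroup E] [InnerProductSpace ℝ E]

/-! Write `A` for the closed complement of `X` and `K` for the set of limits at `x` of gradients of
the distance to `X`. Positive reach enters through proximal normals of one fixed radius: the
defining inequality is closed in the base point and the normal, so such normals survive limits.

Cone of the Clarke gradient inside the normal cone: a nonzero element of `K` is a limit of unit
vectors pointing from a nearest point `p` of `closure X` to a point `y` outside. The ball about `y`
through `p` lies in `A`, which leaves only one possible unit proximal normal of `A` at `p`, the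
opposite vector (`isProxNormal_closedCompl_of_closest`). Passing to the limit puts minus the element
in the normal cone of `A` at `x`; convexity does the rest.

Converse: full dimension makes the normal cone of `A` pointed, so a vector `u` outside the cone of
the Clarke gradient can be separated strictly from the nonzero part of `K` by some `w`
(`exists_separating_of_notMem_coneHull`). The distance to `X` then decreases along `w` near `x`. If
`x - t • w` were interior to `X`, flowing along `w` from points of `X` near it would put points of
`interior A` near `x` into `closure X`, which is absurd. Hence `-w` is tangent to `A`, and `-u` is
not normal to `A`. -/

/-- Every point at distance less than `r` from `A` has a unique closest point in `A`. -/
def UniqueProjWithin (A : Set E) (r : ℝ) : Prop :=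
  ∀ y : E, Metric.infDist y A < r → ∃! a, a ∈ A ∧ dist y a = Metric.infDist y A

/-- `u` is a proximal normal of `A` at `a` with radius `r`; for a unit vector `u` this says that
the open ball of radius `r` centred at `a + r • u` does not meet `A`. -/
def IsProxNormal (A : Set E) (r : ℝ) (a u : E) : Prop :=
  ∀ b ∈ A, 2 * r * inner ℝ (b - a) u ≤ ‖b - a‖ ^ 2

/-! ### Unique projection and proximal normals of uniform radius -/

omit [InnerProductSpace ℝ E] in
lemma exists_uniqueProjWithin_of_reach_pos {A : Set E} (hA : A.Nonempty) (h : 0 < reach A) :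
    ∃ r : ℝ, 0 < r ∧ UniqueProjWithin A r := by
  obtain ⟨t, ht, ht0⟩ := lt_sSup_iff.1 h
  obtain ⟨r, hr0, hrt⟩ := ENNReal.lt_iff_exists_nnreal_btwn.1 ht0
  refine ⟨r, by exact_mod_cast hr0, fun y hy => ht y ?_⟩
  refine lt_trans ?_ hrt
  rw [Metric.infDist] at hy
  rw [← ENNReal.ofReal_toReal (Metric.infEDist_ne_top hA), ← ENNReal.ofReal_coe_nnreal]
  exact (ENNReal.ofReal_lt_ofReal_iff_of_nonneg ENNReal.toReal_nonneg).2 hy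

omit [InnerProductSpace ℝ E] in
lemma exists_subseq_tendsto_of_norm_eq_one [ProperSpace E] {u : ℕ → E} (hu : ∀ n, ‖u n‖ = 1) :
    ∃ m : E, ‖m‖ = 1 ∧ ∃ φ : ℕ → ℕ, StrictMono φ ∧ Tendsto (u ∘ φ) atTop (𝓝 m) := by
  obtain ⟨m, hm, φ, hφ, h⟩ := (isCompact_sphere (0 : E) 1).tendsto_subseq
    (x := u) (fun n => by simp [hu n])
  exact ⟨m, by simpa using hm, φ, hφ, h⟩

-- Closest points of a sequence converging to `y` are bounded, and any cluster point is a closest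
-- point of `y`. Uniqueness is needed at `y` only.
omit [InnerProductSpace ℝ E] in
lemma eventually_dist_closest_lt [ProperSpace E] {A : Set E} (hA : IsClosed A) {y a : E}
    (huniq : ∀ b ∈ A, dist y b = Metric.infDist y A → b = a) {ε : ℝ} (hε : 0 < ε) :
    ∀ᶠ z in 𝓝 y, ∀ b ∈ A, dist z b = Metric.infDist z A → dist b a < ε := by
  by_contra hcon
  obtain ⟨z, hz, hP⟩ := exists_seq_forall_of_frequently (not_eventually.1 hcon)
  push Not at hP
  choose b hbA hb hba using hP
  have hd : Tendsto (fun n => Metric.infDist (z n) A) atTop (𝓝 (Metric.infDist y A)) :=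
    ((Metric.continuous_infDist_pt A).tendsto y).comp hz
  have hbdd : Bornology.IsBounded (Set.range b) := by
    obtain ⟨R, hR⟩ := (Metric.isBounded_range_of_tendsto _ hz).subset_closedBall (0 : E)
    obtain ⟨R', hR'⟩ := (Metric.isBounded_range_of_tendsto _ hd).subset_closedBall (0 : ℝ)
    refine (Metric.isBounded_closedBall (x := (0 : E)) (r := R' + R)).subset ?_
    rintro _ ⟨n, rfl⟩
    have h1 := hR ⟨n, rfl⟩
    have h2 := hR' ⟨n, rfl⟩
    simp only [Metric.mem_closedBall] at h1 h2 ⊢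
    have h3 := dist_triangle (b n) (z n) 0
    rw [dist_comm (b n) (z n), hb n] at h3
    rw [Real.dist_eq, sub_zero, abs_of_nonneg Metric.infDist_nonneg] at h2
    linarith
  obtain ⟨c, -, φ, hφ, hc⟩ := tendsto_subseq_of_bounded hbdd (fun n => Set.mem_range_self n)
  have hcA : c ∈ A := hA.mem_of_tendsto hc (Eventually.of_forall fun n => hbA _)
  have h1 : Tendsto (fun n => dist (z (φ n)) (b (φ n))) atTop (𝓝 (dist y c)) :=
    (hz.comp hφ.tendsto_atTop).dist hc
  have h2 : dist y c = Metric.infDist y A :=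
    tendsto_nhds_unique (h1.congr fun n => hb _) (hd.comp hφ.tendsto_atTop)
  have h3 : ε ≤ dist c a :=
    ge_of_tendsto (hc.dist tendsto_const_nhds) (Eventually.of_forall fun n => hba _)
  rw [huniq c hcA h2, dist_self] at h3
  linarith

/-- A closest point `b` of the displaced point is near `a`, so the direction from `b` to `y` is
nearly `u`; projecting the displaced point minus `b` onto that direction bounds the new distance
from below. -/
lemma eventually_infDist_add_smul_ge [ProperSpace E] {A : Set E} (hA : IsClosed A) {y a : E}
    (haA : a ∈ A) (hya : dist y a = Metric.infDist y A) (hpos : 0 < Metric.infDist y A)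
    (huniq : ∀ b ∈ A, dist y b = Metric.infDist y A → b = a) {c : ℝ} (hc : c < 1) :
    ∀ᶠ h in 𝓝[>] (0 : ℝ), Metric.infDist y A + c * h ≤
      Metric.infDist (y + h • (‖y - a‖⁻¹ • (y - a))) A := by
  set u : E := ‖y - a‖⁻¹ • (y - a) with hu
  have hne : ‖y - a‖ ≠ 0 := by rw [← dist_eq_norm, hya]; exact hpos.ne'
  have hcont : ContinuousAt (fun b : E => inner ℝ u (‖y - b‖⁻¹ • (y - b))) a := by
    have : ContinuousAt (fun b : E => ‖y - b‖⁻¹) a :=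
      ContinuousAt.inv₀ (by fun_prop) hne
    fun_prop
  have hval : inner ℝ u (‖y - a‖⁻¹ • (y - a)) = (1 : ℝ) := by
    rw [← hu, real_inner_self_eq_norm_sq, hu, norm_smul, norm_inv, norm_norm,
      inv_mul_cancel₀ hne, one_pow]
  have hev := hcont.eventually (lt_mem_nhds (show c < inner ℝ u (‖y - a‖⁻¹ • (y - a)) by
    rw [hval]; exact hc))
  obtain ⟨ε, hε, hball⟩ := Metric.eventually_nhds_iff.1 hev
  have hnear := eventually_dist_closest_lt hA huniq hε
  have htend : Tendsto (fun h : ℝ => y + h • u) (𝓝[>] 0) (𝓝 y) := by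
    have : ContinuousAt (fun h : ℝ => y + h • u) 0 := by fun_prop
    simpa using this.tendsto.mono_left nhdsWithin_le_nhds
  filter_upwards [htend.eventually hnear, self_mem_nhdsWithin] with h hh hh0
  obtain ⟨b, hbA, hb⟩ := hA.exists_infDist_eq_dist ⟨a, haA⟩ (y + h • u)
  have h1 := hball (hh b hbA hb.symm)
  have hyb : Metric.infDist y A ≤ ‖y - b‖ := by
    rw [← dist_eq_norm]; exact Metric.infDist_le_dist_of_mem hbA
  have hb0 : ‖y - b‖ ≠ 0 := (hpos.trans_le hyb).ne'
  have hunit : ‖‖y - b‖⁻¹ • (y - b)‖ = 1 := by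
    rw [norm_smul, norm_inv, norm_norm, inv_mul_cancel₀ hb0]
  have h2 := real_inner_le_norm (y + h • u - b) (‖y - b‖⁻¹ • (y - b))
  rw [hunit, mul_one] at h2
  have h3 : inner ℝ (y + h • u - b) (‖y - b‖⁻¹ • (y - b)) =
      ‖y - b‖ + h * inner ℝ u (‖y - b‖⁻¹ • (y - b)) := by
    rw [show y + h • u - b = (y - b) + h • u by abel, inner_add_left, inner_smul_left]
    congr 1
    rw [inner_smul_right, real_inner_self_eq_norm_sq]
    field_simp
  rw [hb, dist_eq_norm]
  have h4 : c * h ≤ h * inner ℝ u (‖y - b‖⁻¹ • (y - b)) := by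
    rw [mul_comm]; exact mul_le_mul_of_nonneg_left h1.le (le_of_lt hh0)
  linarith

/-- A variational argument in place of a flow. For `c < 1`, maximise the distance to `A` minus `c`
times the distance to `z` over a closed ball. An interior maximiser could be improved by moving away
from its closest point, so the maximum is on the sphere. As `c` tends to 1 this yields a point of
the ball at distance at least `s` from `A`, and equality in the triangle inequality puts it on the
ray. -/
lemma UniqueProjWithin.infDist_add_smul [ProperSpace E] {A : Set E} (hA : IsClosed A) {r : ℝ}
    (hr : UniqueProjWithin A r) {z a : E} (haA : a ∈ A) (hza : dist z a = Metric.infDist z A)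
    (hpos : 0 < Metric.infDist z A) {s : ℝ} (hs : Metric.infDist z A ≤ s) (hsr : s < r) :
    Metric.infDist (a + s • (‖z - a‖⁻¹ • (z - a))) A = s := by
  set ρ := Metric.infDist z A with hρ
  set f : E → ℝ := fun y => Metric.infDist y A with hf
  have hfc : Continuous f := Metric.continuous_infDist_pt A
  have hL : 0 ≤ s - ρ := by linarith
  have hcomp : IsCompact (Metric.closedBall z (s - ρ)) := isCompact_closedBall z _
  have hball : (Metric.closedBall z (s - ρ)).Nonempty := ⟨z, Metric.mem_closedBall_self hL⟩
  have hup : ∀ y, f y ≤ ρ + dist y z := fun y => by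
    have := Metric.infDist_le_infDist_add_dist (s := A) (x := y) (y := z)
    simpa [hf, hρ] using this
  have key : ∀ c < (1 : ℝ), 0 < c → ∃ y ∈ Metric.closedBall z (s - ρ), ρ + c * (s - ρ) ≤ f y := by
    intro c hc hc0
    obtain ⟨y, hy, hmax⟩ := hcomp.exists_isMaxOn hball
      (f := fun y => f y - c * dist y z) (by fun_prop)
    refine ⟨y, hy, ?_⟩
    have h0 : ρ ≤ f y - c * dist y z := by
      have := hmax (Metric.mem_closedBall_self hL)
      simpa [hf, hρ] using this
    rcases (Metric.mem_closedBall.1 hy).lt_or_eq with hlt | heq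
    · exfalso
      have hfy : 0 < f y := by nlinarith [dist_nonneg (x := y) (y := z)]
      have hfr : f y < r := by linarith [hup y]
      obtain ⟨b, ⟨hbA, hb⟩, hbu⟩ := hr y hfr
      -- A slope strictly above `c` is what makes the move beat the penalty.
      obtain ⟨c', hcc', hc'⟩ := exists_between hc
      have hg := eventually_infDist_add_smul_ge hA hbA hb hfy (fun b' h1 h2 => hbu b' ⟨h1, h2⟩) hc'
      have hne : ‖y - b‖ ≠ 0 := by rw [← dist_eq_norm, hb]; exact hfy.ne'
      set u : E := ‖y - b‖⁻¹ • (y - b) with hu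
      have hu1 : ‖u‖ = 1 := by rw [hu, norm_smul, norm_inv, norm_norm, inv_mul_cancel₀ hne]
      have hsmall : ∀ᶠ h in 𝓝[>] (0 : ℝ), h < s - ρ - dist y z :=
        nhdsWithin_le_nhds (gt_mem_nhds (by linarith))
      obtain ⟨h, hh1, hh2, hh3⟩ := (hg.and (hsmall.and self_mem_nhdsWithin)).exists
      have hh3 : 0 < h := hh3
      have hd : dist (y + h • u) z ≤ h + dist y z := by
        have := dist_triangle (y + h • u) y z
        rw [dist_eq_norm (y + h • u) y, add_sub_cancel_left, norm_smul, hu1, Real.norm_eq_abs,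
          abs_of_pos hh3, mul_one] at this
        exact this
      have hm := hmax (a := y + h • u) (Metric.mem_closedBall.2 (by linarith))
      simp only [Set.mem_ofPred_eq] at hm
      have hm1 : f y + c' * h ≤ f (y + h • u) := hh1
      have hm2 : c * dist (y + h • u) z ≤ c * (h + dist y z) :=
        mul_le_mul_of_nonneg_left hd hc0.le
      nlinarith
    · rw [← heq]; linarith
  obtain ⟨y, hy, hmax⟩ := hcomp.exists_isMaxOn hball hfc.continuousOn
  have hyge : s ≤ f y := by
    have hlim : Tendsto (fun c : ℝ => ρ + c * (s - ρ)) (𝓝[<] 1) (𝓝 (ρ + 1 * (s - ρ))) := by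
      have : ContinuousAt (fun c : ℝ => ρ + c * (s - ρ)) 1 := by fun_prop
      exact this.tendsto.mono_left nhdsWithin_le_nhds
    have : ρ + 1 * (s - ρ) ≤ f y := by
      refine le_of_tendsto hlim ?_
      filter_upwards [self_mem_nhdsWithin,
        nhdsWithin_le_nhds (lt_mem_nhds (zero_lt_one' ℝ))] with c hc hc0
      obtain ⟨y', hy', h⟩ := key c hc hc0
      exact h.trans (hmax hy')
    linarith
  have hyz : dist y z ≤ s - ρ := hy
  have hya : s ≤ dist y a := hyge.trans (Metric.infDist_le_dist_of_mem haA)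
  have hneza : ‖z - a‖ = ρ := by rw [← dist_eq_norm, hza]
  have hypt : y = a + s • (‖z - a‖⁻¹ • (z - a)) := by
    rw [hneza]
    have e1 : ‖y - z‖ ≤ s - ρ := by rwa [← dist_eq_norm]
    have e2 : s ≤ ‖(y - z) + (z - a)‖ := by rwa [sub_add_sub_cancel, ← dist_eq_norm]
    have e3 : ‖y - z‖ = s - ρ := by linarith [norm_add_le (y - z) (z - a)]
    have e4 : ‖(y - z) + (z - a)‖ = ‖y - z‖ + ‖z - a‖ :=
      le_antisymm (norm_add_le _ _) (by linarith)
    have e5 : SameRay ℝ (y - z) (z - a) := sameRay_iff_norm_add.2 e4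
    have e6 := sameRay_iff_norm_smul_eq.1 e5
    rw [e3, hneza] at e6
    have e7 : y - z = (ρ⁻¹ * (s - ρ)) • (z - a) := by
      rw [mul_smul, e6, smul_smul, inv_mul_cancel₀ hpos.ne', one_smul]
    have e8 : ρ⁻¹ * (s - ρ) = s * ρ⁻¹ - 1 := by field_simp
    rw [e8, sub_smul, one_smul] at e7
    rw [smul_smul, ← sub_eq_iff_eq_add']
    rw [show y - a = (y - z) + (z - a) by abel, e7]
    abel
  rw [← hypt]
  refine le_antisymm ?_ hyge
  linarith [hup y, show f y = Metric.infDist y A from rfl]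

lemma UniqueProjWithin.isProxNormal [ProperSpace E] {A : Set E} (hA : IsClosed A) {r : ℝ}
    (hr : UniqueProjWithin A r) {z a : E} (haA : a ∈ A) (hza : dist z a = Metric.infDist z A)
    (hpos : 0 < Metric.infDist z A) {s : ℝ} (hs : Metric.infDist z A ≤ s) (hsr : s < r) :
    IsProxNormal A s a (‖z - a‖⁻¹ • (z - a)) := by
  intro b hb
  have h := hr.infDist_add_smul hA haA hza hpos hs hsr
  have hne : ‖z - a‖ ≠ 0 := by rw [← dist_eq_norm, hza]; exact hpos.ne'
  set u : E := ‖z - a‖⁻¹ • (z - a) with hu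
  have hu1 : ‖u‖ = 1 := by rw [hu, norm_smul, norm_inv, norm_norm, inv_mul_cancel₀ hne]
  have h1 : s ≤ ‖(b - a) - s • u‖ := by
    rw [← norm_neg, show -((b - a) - s • u) = a + s • u - b by abel, ← dist_eq_norm]
    exact h.symm.le.trans (Metric.infDist_le_dist_of_mem hb)
  have h2 : s ^ 2 ≤ ‖(b - a) - s • u‖ ^ 2 :=
    pow_le_pow_left₀ (hpos.le.trans hs) h1 2
  rw [norm_sub_sq_real, norm_smul, hu1, mul_one, Real.norm_eq_abs, sq_abs, inner_smul_right] at h2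
  linarith

lemma IsProxNormal.of_tendsto {A : Set E} {s : ℝ} {a u : ℕ → E} {a₀ u₀ : E}
    (h : ∀ n, IsProxNormal A s (a n) (u n)) (ha : Tendsto a atTop (𝓝 a₀))
    (hu : Tendsto u atTop (𝓝 u₀)) : IsProxNormal A s a₀ u₀ := by
  intro b hb
  have h1 : Tendsto (fun n => b - a n) atTop (𝓝 (b - a₀)) := tendsto_const_nhds.sub ha
  exact le_of_tendsto_of_tendsto' ((h1.inner hu).const_mul _) (h1.norm.pow 2)
    (fun n => h n b hb)

lemma IsProxNormal.mem_normalCone {A : Set E} {s : ℝ} (hs : 0 < s) {a u : E}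
    (h : IsProxNormal A s a u) : u ∈ normalCone A a := by
  rintro _ ⟨t, ht, v, ⟨y, hy, hya, hyv⟩, rfl⟩
  rw [inner_smul_right]
  refine mul_nonpos_of_nonneg_of_nonpos ht ?_
  have h1 : ∀ n, 2 * s * inner ℝ (‖y n - a‖⁻¹ • (y n - a)) u ≤ ‖y n - a‖ := by
    intro n
    have hne : 0 < ‖y n - a‖ := norm_pos_iff.2 (sub_ne_zero.2 (hy n).2)
    have h2 := h (y n) (hy n).1
    rw [inner_smul_left, RCLike.conj_to_real]
    calc 2 * s * (‖y n - a‖⁻¹ * inner ℝ (y n - a) u)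
        = ‖y n - a‖⁻¹ * (2 * s * inner ℝ (y n - a) u) := by ring
      _ ≤ ‖y n - a‖⁻¹ * ‖y n - a‖ ^ 2 := by gcongr
      _ = ‖y n - a‖ := by field_simp
  have h3 : Tendsto (fun n => ‖y n - a‖) atTop (𝓝 0) := by
    simpa using (hya.sub_const a).norm
  have h4 := le_of_tendsto_of_tendsto' ((hyv.inner (tendsto_const_nhds (x := u))).const_mul (2 * s))
    h3 h1
  rw [real_inner_comm]
  by_contra hcon
  push Not at hcon
  have : 0 < 2 * s * inner ℝ v u := by positivity
  linarith

/-- Project each `z n` to `A`. The whole sequence of foot points and normals is returned, not only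
the limit `m`, because the quantitative estimate in `mem_closure_interior` needs it. -/
lemma UniqueProjWithin.exists_isProxNormal_of_tendsto [ProperSpace E] {A : Set E}
    (hA : IsClosed A) {r : ℝ} (hr : UniqueProjWithin A r) {s : ℝ} (hs : 0 < s) (hsr : s < r)
    {p : E} (hp : p ∈ A) {z : ℕ → E} (hzA : ∀ n, z n ∉ A) (hz : Tendsto z atTop (𝓝 p)) :
    ∃ (a u : ℕ → E) (φ : ℕ → ℕ) (m : E), StrictMono φ ∧ ‖m‖ = 1 ∧ IsProxNormal A s p m ∧
      Tendsto (u ∘ φ) atTop (𝓝 m) ∧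
      ∀ᶠ n in atTop, a n ∈ A ∧ ‖u n‖ = 1 ∧ IsProxNormal A s (a n) (u n) ∧
        z n = a n + Metric.infDist (z n) A • u n := by
  have hne : A.Nonempty := ⟨p, hp⟩
  choose a haA hza using fun n => hA.exists_infDist_eq_dist hne (z n)
  have hpos : ∀ n, 0 < Metric.infDist (z n) A := fun n => (hA.notMem_iff_infDist_pos hne).1 (hzA n)
  have hnz : ∀ n, ‖z n - a n‖ ≠ 0 := fun n => by
    rw [← dist_eq_norm, ← hza]; exact (hpos n).ne'
  set u : ℕ → E := fun n => ‖z n - a n‖⁻¹ • (z n - a n) with hu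
  have hu1 : ∀ n, ‖u n‖ = 1 := fun n => by
    simp only [hu]; rw [norm_smul, norm_inv, norm_norm, inv_mul_cancel₀ (hnz n)]
  have hd : Tendsto (fun n => Metric.infDist (z n) A) atTop (𝓝 0) := by
    have := ((Metric.continuous_infDist_pt A).tendsto p).comp hz
    rwa [Metric.infDist_zero_of_mem hp] at this
  have hprox : ∀ᶠ n in atTop, IsProxNormal A s (a n) (u n) := by
    filter_upwards [hd.eventually (gt_mem_nhds hs)] with n hn
    exact hr.isProxNormal hA (haA n) (hza n).symm (hpos n) hn.le hsr
  have hrel : ∀ n, z n = a n + Metric.infDist (z n) A • u n := fun n => by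
    simp only [hu]
    rw [hza, dist_eq_norm, smul_smul, mul_inv_cancel₀ (hnz n), one_smul]; abel
  have ha : Tendsto a atTop (𝓝 p) := by
    have h1 : Tendsto (fun n => dist (a n) (z n)) atTop (𝓝 0) := by
      refine hd.congr fun n => ?_
      rw [hza, dist_comm]
    exact (tendsto_iff_of_dist h1).2 hz
  obtain ⟨m, hm, φ, hφ, hlim⟩ := exists_subseq_tendsto_of_norm_eq_one hu1
  refine ⟨a, u, φ, m, hφ, hm, ?_, hlim, ?_⟩
  · obtain ⟨N, hN⟩ := eventually_atTop.1 hprox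
    refine IsProxNormal.of_tendsto (a := fun n => a (φ (n + N))) (u := fun n => u (φ (n + N)))
      (fun n => hN _ ?_) ?_ ?_
    · exact (Nat.le_add_left N n).trans (hφ.le_apply)
    · exact (tendsto_add_atTop_iff_nat N).2 (ha.comp hφ.tendsto_atTop)
    · exact (tendsto_add_atTop_iff_nat N).2 hlim
  · filter_upwards [hprox] with n hn
    exact ⟨haA n, hu1 n, hn, hrel n⟩

lemma UniqueProjWithin.exists_unit_isProxNormal [ProperSpace E] {A : Set E}
    (hA : IsClosed A) {r : ℝ} (hr : UniqueProjWithin A r) {s : ℝ} (hs : 0 < s) (hsr : s < r)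
    {p : E} (hp : p ∈ frontier A) : ∃ m : E, ‖m‖ = 1 ∧ IsProxNormal A s p m := by
  have hpA : p ∈ A := hA.frontier_subset hp
  rw [frontier_eq_closure_inter_closure] at hp
  obtain ⟨z, hzA, hz⟩ := mem_closure_iff_seq_limit.1 hp.2
  obtain ⟨-, -, -, m, -, hm, hprox, -⟩ := hr.exists_isProxNormal_of_tendsto hA hs hsr hpA hzA hz
  exact ⟨m, hm, hprox⟩

/-! ### Distance functions: gradients, their limits, and descent -/

/-- The limits of gradients of `f` along sequences of differentiability points converging
to `x`. -/
def gradientLimits [CompleteSpace E] (f : E → ℝ) (x : E) : Set E :=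
  {v | ∃ y : ℕ → E, (∀ n, DifferentiableAt ℝ f (y n)) ∧ Tendsto y atTop (𝓝 x) ∧
    Tendsto (fun n => gradient f (y n)) atTop (𝓝 v)}

lemma hasFDerivAt_norm_sub {y p : E} (h : y ≠ p) :
    HasFDerivAt (fun z => ‖z - p‖) (innerSL ℝ (‖y - p‖⁻¹ • (y - p))) y := by
  have hne : ‖y - p‖ ≠ 0 := norm_ne_zero_iff.2 (sub_ne_zero.2 h)
  have h1 := (((hasFDerivAt_id y).sub_const p).norm_sq).sqrt (by simpa using hne)
  simp only [id, Real.sqrt_sq (norm_nonneg _)] at h1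
  convert h1 using 1
  ext v
  simp
  field_simp

omit [InnerProductSpace ℝ E] in
lemma hasFDerivAt_of_le_of_le [NormedSpace ℝ E] {f g h : E → ℝ} {L : E →L[ℝ] ℝ} {m : E}
    (hg : HasFDerivAt g L m) (hh : HasFDerivAt h L m) (hgf : ∀ z, g z ≤ f z)
    (hfh : ∀ z, f z ≤ h z) (hgm : g m = f m) (hhm : h m = f m) : HasFDerivAt f L m := by
  rw [hasFDerivAt_iff_isLittleO, Asymptotics.isLittleO_iff] at *
  intro c hc
  filter_upwards [hg hc, hh hc] with z h1 h2
  rw [Real.norm_eq_abs, abs_le] at *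
  have := hgf z
  have := hfh z
  constructor <;> linarith [h1.1, h2.2]

/-- The function `‖z - p‖` minus the distance to `S` has a minimum at `y`, so the two derivatives
agree there. -/
lemma gradient_infDist_of_pos [CompleteSpace E] {S : Set E} {y p : E}
    (hd : DifferentiableAt ℝ (fun z => Metric.infDist z S) y) (hp : p ∈ S)
    (hyp : dist y p = Metric.infDist y S) (hpos : 0 < Metric.infDist y S) :
    gradient (fun z => Metric.infDist z S) y = ‖y - p‖⁻¹ • (y - p) := by
  have hne : y ≠ p := dist_pos.1 (hyp ▸ hpos)
  have h1 := hasFDerivAt_norm_sub hne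
  have hmin : IsLocalMin (fun z => ‖z - p‖ - Metric.infDist z S) y := by
    refine Eventually.of_forall fun z => ?_
    have h2 : Metric.infDist z S ≤ ‖z - p‖ := by
      rw [← dist_eq_norm]; exact Metric.infDist_le_dist_of_mem hp
    simp only [← dist_eq_norm, hyp, sub_self] at h2 ⊢
    linarith
  have h3 := hmin.hasFDerivAt_eq_zero (h1.sub hd.hasFDerivAt)
  refine HasGradientAt.gradient ?_
  rw [hasGradientAt_iff_hasFDerivAt]
  have h4 := hd.hasFDerivAt
  rw [← sub_eq_zero.1 h3] at h4
  exact h4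

lemma gradient_infDist_of_eq_zero [CompleteSpace E] {S : Set E} {y : E}
    (hy : Metric.infDist y S = 0) : gradient (fun z => Metric.infDist z S) y = 0 := by
  have hmin : IsLocalMin (fun z => Metric.infDist z S) y :=
    Eventually.of_forall fun z => by simp only [hy]; exact Metric.infDist_nonneg
  rw [gradient, hmin.fderiv_eq_zero, map_zero]

/-- The distance is squeezed between `‖y - p‖ - ‖z - y‖` and `‖z - p‖`, which agree to first order
at the midpoint. This supplies differentiability points with the right gradient even when `y` is not
one, without any almost-everywhere theorem. -/
lemma hasGradientAt_infDist_midpoint [CompleteSpace E] {S : Set E} {y p : E} (hp : p ∈ S)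
    (hyp : dist y p = Metric.infDist y S) (hpos : 0 < Metric.infDist y S) :
    HasGradientAt (fun z => Metric.infDist z S) (‖y - p‖⁻¹ • (y - p)) (midpoint ℝ y p) := by
  have hne : y ≠ p := dist_pos.1 (hyp ▸ hpos)
  set m := midpoint ℝ y p with hm
  have hmp : m - p = (1 / 2 : ℝ) • (y - p) := by
    rw [hm, midpoint_eq_smul_add, invOf_eq_inv]; module
  have hmy : m - y = (-(1 / 2) : ℝ) • (y - p) := by
    rw [hm, midpoint_eq_smul_add, invOf_eq_inv]; module
  have hn0 : 0 < ‖y - p‖ := norm_pos_iff.2 (sub_ne_zero.2 hne)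
  have n1 : ‖m - p‖ = ‖y - p‖ / 2 := by rw [hmp, norm_smul]; norm_num; ring
  have n2 : ‖m - y‖ = ‖y - p‖ / 2 := by rw [hmy, norm_smul]; norm_num; ring
  have hmp' : m ≠ p := fun h => by rw [h, sub_self, norm_zero] at n1; linarith
  have hmy' : m ≠ y := fun h => by rw [h, sub_self, norm_zero] at n2; linarith
  have e1 : ‖m - p‖⁻¹ • (m - p) = ‖y - p‖⁻¹ • (y - p) := by
    rw [n1, hmp, smul_smul]; congr 1; field_simp
  have e2 : ‖m - y‖⁻¹ • (m - y) = -(‖y - p‖⁻¹ • (y - p)) := by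
    rw [n2, hmy, smul_smul, ← neg_smul]; congr 1; field_simp
  have h1 := hasFDerivAt_norm_sub hmp'
  have h2 := (hasFDerivAt_norm_sub hmy').const_sub ‖y - p‖
  rw [e1] at h1
  rw [e2, map_neg, neg_neg] at h2
  have hle : ∀ z, Metric.infDist z S ≤ ‖z - p‖ := fun z => by
    rw [← dist_eq_norm]; exact Metric.infDist_le_dist_of_mem hp
  have hge : ∀ z, ‖y - p‖ - ‖z - y‖ ≤ Metric.infDist z S := fun z => by
    have := Metric.infDist_le_infDist_add_dist (s := S) (x := y) (y := z)
    rw [← hyp, dist_comm y z, dist_eq_norm, dist_eq_norm] at this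
    linarith
  have hm1 : Metric.infDist m S = ‖y - p‖ / 2 := by
    apply le_antisymm
    · exact (hle m).trans n1.le
    · have := hge m; rw [n2] at this; linarith
  rw [hasGradientAt_iff_hasFDerivAt]
  refine hasFDerivAt_of_le_of_le h2 h1 hge hle ?_ ?_
  · rw [hm1, n2]; ring
  · rw [hm1, n1]

lemma mem_gradientLimits_infDist [CompleteSpace E] {S : Set E} {x q : E}
    (hx : Metric.infDist x S = 0) {y p : ℕ → E} (hy : Tendsto y atTop (𝓝 x))
    (hp : ∀ n, p n ∈ S) (hyp : ∀ n, dist (y n) (p n) = Metric.infDist (y n) S)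
    (hpos : ∀ n, 0 < Metric.infDist (y n) S)
    (hq : Tendsto (fun n => ‖y n - p n‖⁻¹ • (y n - p n)) atTop (𝓝 q)) :
    q ∈ gradientLimits (fun z => Metric.infDist z S) x := by
  have hg := fun n => hasGradientAt_infDist_midpoint (hp n) (hyp n) (hpos n)
  refine ⟨fun n => midpoint ℝ (y n) (p n), fun n => (hg n).differentiableAt, ?_, ?_⟩
  · have hpx : Tendsto p atTop (𝓝 x) := by
      have h1 : Tendsto (fun n => dist (p n) (y n)) atTop (𝓝 0) := by
        have := ((Metric.continuous_infDist_pt S).tendsto x).comp hy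
        rw [hx] at this
        exact this.congr fun n => by rw [Function.comp_apply, ← hyp, dist_comm]
      exact (tendsto_iff_of_dist h1).2 hy
    have := (hy.add hpx).const_smul (2⁻¹ : ℝ)
    rw [← two_smul ℝ x, smul_smul, inv_mul_cancel₀ two_ne_zero, one_smul] at this
    refine this.congr fun n => ?_
    rw [midpoint_eq_smul_add, invOf_eq_inv]
  · exact hq.congr fun n => (hg n).gradient.symm

lemma isClosed_gradientLimits [CompleteSpace E] (f : E → ℝ) (x : E) :
    IsClosed (gradientLimits f x) := by
  refine isClosed_of_closure_subset fun v hv => ?_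
  have h : ∀ n : ℕ, ∃ y, DifferentiableAt ℝ f y ∧ dist y x < 1 / ((n : ℝ) + 1) ∧
      dist (gradient f y) v < 2 * (1 / ((n : ℝ) + 1)) := by
    intro n
    have hε : 0 < 1 / ((n : ℝ) + 1) := Nat.one_div_pos_of_nat
    obtain ⟨v', ⟨y, hy, hyx, hyv⟩, hvv⟩ := Metric.mem_closure_iff.1 hv _ hε
    obtain ⟨k, h1, h2⟩ := ((hyx.eventually (Metric.ball_mem_nhds x hε)).and
      (hyv.eventually (Metric.ball_mem_nhds v' hε))).exists
    refine ⟨y k, hy k, h1, ?_⟩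
    have h2 : dist (gradient f (y k)) v' < _ := h2
    linarith [dist_triangle (gradient f (y k)) v' v, dist_comm v v']
  choose y hy hyx hyv using h
  have h0 := tendsto_one_div_add_atTop_nhds_zero_nat (𝕜 := ℝ)
  refine ⟨y, hy, tendsto_iff_dist_tendsto_zero.2 ?_, tendsto_iff_dist_tendsto_zero.2 ?_⟩
  · exact squeeze_zero (fun _ => dist_nonneg) (fun n => (hyx n).le) h0
  · exact squeeze_zero (fun _ => dist_nonneg) (fun n => (hyv n).le) (by simpa using h0.const_mul 2)

lemma norm_gradient_infDist [ProperSpace E] {S : Set E} (hS : IsClosed S)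
    (hne : S.Nonempty) {y : E} (hd : DifferentiableAt ℝ (fun z => Metric.infDist z S) y) :
    ‖gradient (fun z => Metric.infDist z S) y‖ ∈ ({0, 1} : Set ℝ) := by
  rcases Metric.infDist_nonneg (x := y) (s := S).eq_or_lt with h | h
  · rw [gradient_infDist_of_eq_zero h.symm, norm_zero]; simp
  · obtain ⟨p, hp, hyp⟩ := hS.exists_infDist_eq_dist hne y
    rw [gradient_infDist_of_pos hd hp hyp.symm h, norm_smul, norm_inv, norm_norm,
      inv_mul_cancel₀]
    · simp
    · rw [← dist_eq_norm, ← hyp]; exact h.ne'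

lemma norm_of_mem_gradientLimits_infDist [ProperSpace E] {S : Set E} (hS : IsClosed S)
    (hne : S.Nonempty) {x v : E} (hv : v ∈ gradientLimits (fun z => Metric.infDist z S) x) :
    v = 0 ∨ ‖v‖ = 1 := by
  obtain ⟨y, hy, -, hyv⟩ := hv
  have : ‖v‖ ∈ ({0, 1} : Set ℝ) :=
    (Set.toFinite _).isClosed.mem_of_tendsto hyv.norm
      (Eventually.of_forall fun n => norm_gradient_infDist hS hne (hy n))
  simpa using this

lemma zero_mem_gradientLimits_infDist [CompleteSpace E] {S : Set E} {x : E}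
    (hx : x ∈ closure (interior S)) :
    (0 : E) ∈ gradientLimits (fun z => Metric.infDist z S) x := by
  obtain ⟨y, hyS, hyx⟩ := mem_closure_iff_seq_limit.1 hx
  refine ⟨y, fun n => ?_, hyx, ?_⟩
  · have : (fun z => Metric.infDist z S) =ᶠ[𝓝 (y n)] fun _ => 0 := by
      filter_upwards [isOpen_interior.mem_nhds (hyS n)] with z hz
      exact Metric.infDist_zero_of_mem (interior_subset hz)
    exact (differentiableAt_const (0 : ℝ)).congr_of_eventuallyEq this
  · refine tendsto_const_nhds.congr fun n => ?_
    rw [gradient_infDist_of_eq_zero (Metric.infDist_zero_of_mem (interior_subset (hyS n)))]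

/-- Distance to a closest point `p` dominates the distance to `S`, so its derivative bounds the
right slopes. They are negative wherever the distance is positive, hence no level `ε > 0` can be
crossed. -/
lemma infDist_add_smul_eq_zero_of_descent {S : Set E} {y w : E} {T : ℝ} (hT : 0 ≤ T)
    (hy : Metric.infDist y S = 0)
    (hdesc : ∀ t ∈ Set.Icc 0 T, 0 < Metric.infDist (y + t • w) S →
      ∃ p ∈ S, dist (y + t • w) p = Metric.infDist (y + t • w) S ∧
        inner ℝ (y + t • w - p) w < 0) :
    Metric.infDist (y + T • w) S = 0 := by
  set g : ℝ → ℝ := fun t => Metric.infDist (y + t • w) S with hg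
  have hgc : Continuous g := (Metric.continuous_infDist_pt S).comp (by fun_prop)
  have hslope : ∀ t, ∃ f' : ℝ, t ∈ Set.Icc 0 T →
      (∀ r, f' < r → ∃ᶠ z in 𝓝[>] t, slope g t z < r) ∧ (0 < g t → f' < 0) := by
    intro t
    by_cases ht : t ∈ Set.Icc 0 T
    swap
    · exact ⟨0, fun h => absurd h ht⟩
    by_cases hpos : 0 < g t
    · obtain ⟨p, hpS, hp, hneg⟩ := hdesc t ht hpos
      have hne : y + t • w ≠ p := dist_pos.1 (hp ▸ hpos)
      have hn0 : 0 < ‖y + t • w - p‖ := norm_pos_iff.2 (sub_ne_zero.2 hne)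
      refine ⟨‖y + t • w - p‖⁻¹ * inner ℝ (y + t • w - p) w, fun _ => ⟨fun r hr => ?_, fun _ =>
        mul_neg_of_pos_of_neg (inv_pos.2 hn0) hneg⟩⟩
      have hline : HasDerivAt (fun s : ℝ => y + s • w) w t := by
        simpa using ((hasDerivAt_id t).smul_const w).const_add y
      have h1 := (hasFDerivAt_norm_sub hne).comp_hasDerivAt t hline
      rw [innerSL_apply_apply, inner_smul_left, RCLike.conj_to_real] at h1
      have h2 := (hasDerivAt_iff_tendsto_slope.1 h1).mono_left
        (nhdsWithin_mono t (fun z (hz : t < z) => hz.ne'))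
      refine Eventually.frequently ?_
      filter_upwards [h2.eventually (gt_mem_nhds hr), self_mem_nhdsWithin] with z hz htz
      refine lt_of_le_of_lt ?_ hz
      rw [slope_def_field, slope_def_field]
      have htz' : 0 < z - t := sub_pos.2 htz
      gcongr
      · rw [Function.comp_apply, ← dist_eq_norm]; exact Metric.infDist_le_dist_of_mem hpS
      · rw [Function.comp_apply, ← dist_eq_norm]; exact hp.le
    -- Where the distance vanishes only the Lipschitz bound is available; it suffices, since
    -- negativity is asked only at the level `ε`.
    · refine ⟨‖w‖, fun _ => ⟨fun r hr => Eventually.frequently ?_, fun h => absurd h hpos⟩⟩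
      filter_upwards [self_mem_nhdsWithin] with z hz
      have htz' : 0 < z - t := sub_pos.2 hz
      refine lt_of_le_of_lt ?_ hr
      rw [slope_def_field, div_le_iff₀ htz']
      have := Metric.infDist_le_infDist_add_dist (s := S) (x := y + z • w) (y := y + t • w)
      rw [dist_eq_norm, add_sub_add_left_eq_sub, ← sub_smul, norm_smul, Real.norm_eq_abs,
        abs_of_pos htz', mul_comm] at this
      simp only [hg]; linarith
  choose f' hf' using hslope
  refine le_antisymm (le_of_forall_pos_le_add fun ε hε => ?_) Metric.infDist_nonneg
  rw [zero_add]
  refine image_le_of_liminf_slope_right_lt_deriv_boundary (f := g) (f' := f')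
    (B := fun _ => ε) (B' := fun _ => 0) hgc.continuousOn
    (fun t ht => (hf' t (Set.Ico_subset_Icc_self ht)).1) ?_ (fun t => hasDerivAt_const t ε)
    (fun t ht h => (hf' t (Set.Ico_subset_Icc_self ht)).2 (by rw [h]; exact hε))
    (Set.right_mem_Icc.2 hT)
  simp only [hg, zero_smul, add_zero, hy]; exact hε.le

/-! ### Convex hulls, cones and polars -/

-- By Carathéodory, the hull is a continuous image of a simplex times a finite power of `K`; shorter
-- combinations are padded with weight 0 at `k`.
omit [InnerProductSpace ℝ E] in
lemma isCompact_convexHull [NormedSpace ℝ E] [FiniteDimensional ℝ E] {K : Set E}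
    (hK : IsCompact K) : IsCompact (convexHull ℝ K) := by
  classical
  rcases K.eq_empty_or_nonempty with rfl | ⟨k, hk⟩
  · simp
  set ι := Fin (Module.finrank ℝ E + 1)
  have hC : IsCompact (stdSimplex ℝ ι ×ˢ Set.univ.pi fun _ : ι => K) :=
    (isCompact_stdSimplex ℝ ι).prod (isCompact_univ_pi fun _ => hK)
  convert! hC.image (f := fun wz : (ι → ℝ) × (ι → E) => ∑ i, wz.1 i • wz.2 i) (by fun_prop) using 1
  refine Set.Subset.antisymm (fun v hv => ?_) ?_
  · obtain ⟨ι', _, z, w, hz, hind, hw, hw1, hwz⟩ := eq_pos_convex_span_of_mem_convexHull hv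
    have hcard : Fintype.card ι' ≤ Fintype.card ι := by
      rw [Fintype.card_fin]
      refine (hind.card_le_finrank_succ).trans ?_
      gcongr
      exact Submodule.finrank_le _
    obtain ⟨e⟩ := Function.Embedding.nonempty_of_card_le hcard
    have hwe : ∀ i, Function.extend e w 0 (e i) = w i := e.injective.extend_apply w 0
    have hze : ∀ i, Function.extend e z (fun _ => k) (e i) = z i := e.injective.extend_apply z _
    have hw0 : ∀ i ∉ Set.range e, Function.extend e w 0 i = 0 := fun i hi =>
      Function.extend_apply' _ _ _ hi
    refine ⟨(Function.extend e w 0, Function.extend e z fun _ => k), ⟨⟨fun i => ?_, ?_⟩, ?_⟩, ?_⟩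
    · by_cases hi : i ∈ Set.range e
      · obtain ⟨j, rfl⟩ := hi
        simp only [hwe]; exact (hw j).le
      · simp only [hw0 i hi]; exact le_rfl
    · rw [← hw1]
      exact (Fintype.sum_of_injective e e.injective _ _ hw0 fun i => (hwe i).symm).symm
    · intro i _
      by_cases hi : i ∈ Set.range e
      · obtain ⟨j, rfl⟩ := hi
        simp only [hze]; exact hz ⟨j, rfl⟩
      · simp only [Function.extend_apply' _ _ _ hi]; exact hk
    · rw [← hwz]
      refine (Fintype.sum_of_injective e e.injective _ _ (fun i hi => ?_) fun i => ?_).symm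
      · simp only [hw0 i hi, zero_smul]
      · simp only [hwe, hze]
  · rintro _ ⟨⟨w, z⟩, ⟨⟨hw, hw1⟩, hz⟩, rfl⟩
    exact (convex_convexHull ℝ K).sum_mem (fun i _ => hw i) hw1
      fun i _ => subset_convexHull ℝ K (hz i trivial)

lemma convex_coneHull {C : Set E} (hC : Convex ℝ C) : Convex ℝ (coneHull C) := by
  rintro _ ⟨s, hs, b, hb, rfl⟩ _ ⟨t, ht, c, hc, rfl⟩ α β hα hβ -
  have h1 : 0 ≤ α * s := mul_nonneg hα hs
  have h2 : 0 ≤ β * t := mul_nonneg hβ ht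
  rcases (add_nonneg h1 h2).eq_or_lt with h | h
  · have e1 : α * s = 0 := by linarith
    have e2 : β * t = 0 := by linarith
    exact ⟨0, le_rfl, b, hb, by simp [smul_smul, e1, e2]⟩
  · refine ⟨α * s + β * t, h.le, _, hC hb hc (div_nonneg h1 h.le) (div_nonneg h2 h.le)
      (by rw [← add_div, div_self h.ne']), ?_⟩
    rw [smul_add, smul_smul, smul_smul, smul_smul, smul_smul, mul_div_cancel₀ _ h.ne',
      mul_div_cancel₀ _ h.ne']

lemma convex_polarCone (B : Set E) : Convex ℝ (polarCone B) := by
  intro u hu v hv α β hα hβ _ b hb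
  rw [inner_add_left, inner_smul_left, inner_smul_left]
  exact add_nonpos (mul_nonpos_of_nonneg_of_nonpos hα (hu b hb))
    (mul_nonpos_of_nonneg_of_nonpos hβ (hv b hb))

lemma smul_mem_polarCone {B : Set E} {t : ℝ} (ht : 0 ≤ t) {u : E} (hu : u ∈ polarCone B) :
    t • u ∈ polarCone B := by
  intro b hb
  rw [inner_smul_left]
  exact mul_nonpos_of_nonneg_of_nonpos ht (hu b hb)

/-- Take `e` to be the sum of a finite spanning subset of `B`: a polar vector orthogonal to this sum
is orthogonal to each term, hence zero. -/
lemma exists_inner_neg_of_span_eq_top [FiniteDimensional ℝ E] {B : Set E}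
    (hB : Submodule.span ℝ B = ⊤) :
    ∃ e : E, ∀ n ∈ polarCone B, n ≠ 0 → inner ℝ n e < 0 := by
  obtain ⟨s, hsB, hs⟩ := (Submodule.fg_span_iff_fg_span_finset_subset B).1
    (IsNoetherian.noetherian (Submodule.span ℝ B))
  refine ⟨∑ v ∈ s, v, fun n hn hn0 => ?_⟩
  rw [inner_sum]
  refine lt_of_le_of_ne (Finset.sum_nonpos fun v hv => hn v (hsB hv)) fun h => hn0 ?_
  have h0 := (Finset.sum_eq_zero_iff_of_nonpos fun v hv => hn v (hsB hv)).1 h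
  have hle : Submodule.span ℝ (s : Set E) ≤ LinearMap.ker (innerₛₗ ℝ n) :=
    Submodule.span_le.2 fun v hv => h0 v hv
  rw [← hs, hB] at hle
  have : inner ℝ n n = (0 : ℝ) := hle (Submodule.mem_top (x := n))
  exact inner_self_eq_zero.1 this

lemma mem_tangentCone_of_forall_add_smul_mem {A : Set E} {x w : E} {ε : ℝ} (hε : 0 < ε) (hw : w ≠ 0)
    (h : ∀ t : ℝ, 0 < t → t < ε → x + t • w ∈ A) : w ∈ tangentCone A x := by
  obtain ⟨N, hN⟩ := exists_nat_one_div_lt hε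
  have hpos : ∀ n : ℕ, 0 < 1 / (((n + N : ℕ) : ℝ) + 1) := fun n => Nat.one_div_pos_of_nat
  have hlt : ∀ n : ℕ, 1 / (((n + N : ℕ) : ℝ) + 1) < ε := fun n =>
    (Nat.one_div_le_one_div (Nat.le_add_left N n)).trans_lt hN
  refine ⟨‖w‖, norm_nonneg _, ‖w‖⁻¹ • w,
    ⟨fun n => x + (1 / (((n + N : ℕ) : ℝ) + 1)) • w, fun n => ⟨h _ (hpos n) (hlt n), ?_⟩, ?_, ?_⟩, ?_⟩
  · simp only [ne_eq, add_eq_left, smul_eq_zero, hw, (hpos n).ne', or_self, not_false_eq_true]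
  · have h1 := (tendsto_add_atTop_iff_nat N).2 (tendsto_one_div_add_atTop_nhds_zero_nat (𝕜 := ℝ))
    simpa using (h1.smul_const w).const_add x
  · refine tendsto_const_nhds.congr fun n => ?_
    rw [add_sub_cancel_left, norm_smul, Real.norm_eq_abs, abs_of_pos (hpos n), smul_smul]
    congr 1
    have := hpos n
    have := norm_pos_iff.2 hw
    field_simp
  · rw [smul_smul, mul_inv_cancel₀ (norm_ne_zero_iff.2 hw), one_smul]

/-! ### Local structure of the closed complement and its normals -/

/-- If the points `x + t • e` were not interior for small `t > 0`, points outside `A` very near them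
would have proximal normals accumulating at a unit normal `m` at `x`. Testing the proximal
inequality against `x` itself gives `0 ≤ inner ℝ m e`, contrary to the choice of `e`. -/
lemma UniqueProjWithin.mem_closure_interior [ProperSpace E] {A : Set E} (hA : IsClosed A)
    {r : ℝ} (hr : UniqueProjWithin A r) (hr0 : 0 < r) {x : E} (hx : x ∈ A) {e : E}
    (he : ∀ n ∈ normalCone A x, n ≠ 0 → inner ℝ n e < 0) : x ∈ closure (interior A) := by
  by_contra hcon
  obtain ⟨ε, hε, hball⟩ := Metric.isOpen_iff.1 isClosed_closure.isOpen_compl x hcon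
  set s := r / 2 with hs
  have hs0 : 0 < s := by positivity
  obtain ⟨t, htanti, htpos, ht0⟩ := exists_seq_strictAnti_tendsto (0 : ℝ)
  have hte : Tendsto (fun n => x + t n • e) atTop (𝓝 x) := by
    simpa using (ht0.smul_const e).const_add x
  obtain ⟨N, hN⟩ := eventually_atTop.1 (hte.eventually (Metric.ball_mem_nhds x hε))
  -- The error `t ^ 2` is negligible against the displacement of order `t`.
  have hz : ∀ n, ∃ z ∉ A, dist (x + t (n + N) • e) z < t (n + N) ^ 2 := by
    intro n
    have h1 : x + t (n + N) • e ∉ interior A := fun h =>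
      hball (hN (n + N) (Nat.le_add_left N n)) (subset_closure h)
    have h2 : x + t (n + N) • e ∈ closure Aᶜ := by rwa [closure_compl]
    obtain ⟨z, hzA, hz⟩ := Metric.mem_closure_iff.1 h2 (t (n + N) ^ 2) (pow_pos (htpos _) 2)
    exact ⟨z, hzA, hz⟩
  choose z hzA hz using hz
  set τ : ℕ → ℝ := fun n => t (n + N) with hτ
  have hτ0 : Tendsto τ atTop (𝓝 0) := (tendsto_add_atTop_iff_nat N).2 ht0
  have hτpos : ∀ n, 0 < τ n := fun n => htpos _
  have hτe : Tendsto (fun n => x + τ n • e) atTop (𝓝 x) := by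
    simpa using (hτ0.smul_const e).const_add x
  have hzx : Tendsto z atTop (𝓝 x) := by
    have h1 : Tendsto (fun n => dist (x + τ n • e) (z n)) atTop (𝓝 0) :=
      squeeze_zero (fun _ => dist_nonneg) (fun n => (hz n).le) (by simpa using hτ0.pow 2)
    exact (tendsto_iff_of_dist h1).1 hτe
  obtain ⟨a, u, φ, m, hφ, hm, hprox, hum, hev⟩ :=
    hr.exists_isProxNormal_of_tendsto hA hs0 (by linarith) hx hzA hzx
  have hme : inner ℝ m e < 0 := he m (hprox.mem_normalCone hs0) (norm_ne_zero_iff.1 (by simp [hm]))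
  have hτ1 : ∀ᶠ n in atTop, τ n ≤ 1 := (hτ0.eventually (gt_mem_nhds one_pos)).mono fun _ h => h.le
  have hbound : ∀ᶠ n in atTop,
      -(2 * s * inner ℝ (u n) e) ≤ (4 * (‖e‖ + 1) ^ 2 + 2 * s) * τ n := by
    filter_upwards [hev, hτ1] with n ⟨han, hun, hpn, hzn⟩ hτn
    have hτn0 := hτpos n
    set δ := Metric.infDist (z n) A with hδ
    have hδ0 : 0 ≤ δ := Metric.infDist_nonneg
    have hd2 : ‖x + τ n • e - z n‖ ≤ τ n ^ 2 := by rw [← dist_eq_norm]; exact (hz n).le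
    have hzx' : dist (z n) x ≤ τ n * (‖e‖ + 1) := by
      have h1 := dist_triangle_left (z n) x (x + τ n • e)
      rw [dist_eq_norm (x + τ n • e) x, add_sub_cancel_left, norm_smul,
        Real.norm_eq_abs, abs_of_pos hτn0] at h1
      nlinarith [hz n]
    have hδle : δ ≤ τ n * (‖e‖ + 1) := (Metric.infDist_le_dist_of_mem hx).trans hzx'
    have hxa : ‖x - a n‖ ≤ 2 * (τ n * (‖e‖ + 1)) := by
      have h1 : x - a n = (x - z n) + δ • u n := by rw [hzn]; abel
      rw [h1]
      refine (norm_add_le _ _).trans ?_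
      rw [norm_smul, hun, Real.norm_eq_abs, abs_of_nonneg hδ0, ← dist_eq_norm, dist_comm]
      linarith
    -- The term `δ • u n` contributes `δ ≥ 0` and is dropped.
    have hin : -(τ n * inner ℝ (u n) e) - τ n ^ 2 ≤ inner ℝ (x - a n) (u n) := by
      have h1 : x - a n = (x + τ n • e - z n) - τ n • e + δ • u n := by
        rw [hzn]; abel
      rw [h1, inner_add_left, inner_sub_left, inner_smul_left, inner_smul_left,
        real_inner_self_eq_norm_sq, hun, real_inner_comm e]
      have h2 := abs_le.1 (abs_real_inner_le_norm (x + τ n • e - z n) (u n))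
      rw [hun, mul_one] at h2
      simp only [RCLike.conj_to_real]
      linarith [h2.1]
    have hp := hpn x hx
    have hsq : ‖x - a n‖ ^ 2 ≤ (2 * (τ n * (‖e‖ + 1))) ^ 2 :=
      pow_le_pow_left₀ (norm_nonneg _) hxa 2
    have hmul : 2 * s * (-(τ n * inner ℝ (u n) e) - τ n ^ 2) ≤ 2 * s * inner ℝ (x - a n) (u n) :=
      mul_le_mul_of_nonneg_left hin (by positivity)
    refine le_of_mul_le_mul_left ?_ hτn0
    nlinarith
  have hlim1 : Tendsto (fun n => -(2 * s * inner ℝ (u (φ n)) e)) atTop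
      (𝓝 (-(2 * s * inner ℝ m e))) :=
    ((hum.inner (tendsto_const_nhds (x := e))).const_mul (2 * s)).neg
  have hlim2 : Tendsto (fun n => (4 * (‖e‖ + 1) ^ 2 + 2 * s) * τ (φ n)) atTop (𝓝 0) := by
    simpa using (hτ0.comp hφ.tendsto_atTop).const_mul (4 * (‖e‖ + 1) ^ 2 + 2 * s)
  have := le_of_tendsto_of_tendsto hlim1 hlim2 (hφ.tendsto_atTop.eventually hbound)
  nlinarith

/-- Test with `v = m + q`: its inner products with `q` and with `m` are both `1 + inner ℝ m q`. -/
lemma eq_neg_of_forall_inner_pos {q m : E} (hq : ‖q‖ = 1) (hm : ‖m‖ = 1)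
    (h : ∀ v, 0 < inner ℝ v q → inner ℝ v m ≤ 0) : m = -q := by
  by_contra hne
  have h1 : (-1 : ℝ) < inner ℝ m q := by
    have h2 := norm_add_sq_real m q
    have h3 : 0 < ‖m + q‖ ^ 2 := by
      have : 0 < ‖m + q‖ := norm_pos_iff.2 fun h0 => hne (eq_neg_of_add_eq_zero_left h0)
      positivity
    rw [hm, hq] at h2
    linarith
  have h4 := h (m + q) (by
    rw [inner_add_left, real_inner_self_eq_norm_sq, hq]; linarith)
  rw [inner_add_left, real_inner_self_eq_norm_sq, hm, real_inner_comm] at h4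
  linarith

omit [InnerProductSpace ℝ E] in
lemma isClosed_closedCompl (X : Set E) : IsClosed (closedCompl X) := isClosed_closure

omit [InnerProductSpace ℝ E] in
lemma compl_closedCompl (X : Set E) : (closedCompl X)ᶜ = interior X := by
  rw [closedCompl, closure_compl, compl_compl]

lemma isProxNormal_closedCompl_of_closest [ProperSpace E] {X : Set E}
    (hX : X ⊆ closure (interior X)) {r : ℝ} (hr : UniqueProjWithin (closedCompl X) r) {s : ℝ}
    (hs : 0 < s) (hsr : s < r) {y p : E} (hp : p ∈ closure X)
    (hyp : dist y p = Metric.infDist y (closure X)) (hpos : 0 < Metric.infDist y (closure X)) :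
    IsProxNormal (closedCompl X) s p (-(‖y - p‖⁻¹ • (y - p))) := by
  have hne : y ≠ p := dist_pos.1 (hyp ▸ hpos)
  have hn0 : 0 < ‖y - p‖ := norm_pos_iff.2 (sub_ne_zero.2 hne)
  have hball : Metric.ball y ‖y - p‖ ⊆ closedCompl X := fun z hz => by
    refine subset_closure fun hzX => ?_
    have := Metric.infDist_le_dist_of_mem (x := y) (subset_closure hzX)
    rw [← hyp, dist_eq_norm y p, dist_comm] at this
    exact absurd (Metric.mem_ball.1 hz) (not_lt.2 this)
  -- Directions making an acute angle with `y - p` enter the ball at once, so `A` contains a tangent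
  -- half-space at `p`.
  have hray : ∀ v : E, 0 < inner ℝ v (y - p) →
      ∀ᶠ h in 𝓝[>] (0 : ℝ), p + h • v ∈ closedCompl X := by
    intro v hv
    have h1 : Tendsto (fun h : ℝ => h * ‖v‖ ^ 2) (𝓝[>] 0) (𝓝 (0 * ‖v‖ ^ 2)) :=
      ((continuous_mul_const _).tendsto 0).mono_left nhdsWithin_le_nhds
    rw [zero_mul] at h1
    filter_upwards [h1.eventually (gt_mem_nhds (show 0 < 2 * inner ℝ v (y - p) by linarith)),
      self_mem_nhdsWithin] with h hh hh0
    have hh0 : 0 < h := hh0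
    refine hball (Metric.mem_ball.2 ?_)
    rw [dist_eq_norm, show p + h • v - y = h • v - (y - p) by abel]
    refine lt_of_pow_lt_pow_left₀ 2 hn0.le ?_
    rw [norm_sub_sq_real, norm_smul, inner_smul_left, Real.norm_eq_abs, mul_pow, sq_abs]
    simp only [RCLike.conj_to_real]
    nlinarith
  have hpf : p ∈ frontier (closedCompl X) := by
    rw [frontier_eq_closure_inter_closure, compl_closedCompl]
    refine ⟨?_, closure_minimal hX isClosed_closure hp⟩
    have h1 : Tendsto (fun h : ℝ => p + h • (y - p)) (𝓝[>] 0) (𝓝 p) := by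
      have : ContinuousAt (fun h : ℝ => p + h • (y - p)) 0 := by fun_prop
      simpa using this.tendsto.mono_left nhdsWithin_le_nhds
    exact mem_closure_of_tendsto h1 (hray (y - p) (by
      rw [real_inner_self_eq_norm_sq]; positivity))
  obtain ⟨m, hm, hprox⟩ := hr.exists_unit_isProxNormal (isClosed_closedCompl X) hs hsr hpf
  have hmq : m = -(‖y - p‖⁻¹ • (y - p)) := by
    refine eq_neg_of_forall_inner_pos ?_ hm fun v hv => ?_
    · rw [norm_smul, norm_inv, norm_norm, inv_mul_cancel₀ hn0.ne']
    · rw [inner_smul_right] at hv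
      have hv' := pos_of_mul_pos_right hv (inv_nonneg.2 hn0.le)
      have h1 : Tendsto (fun h : ℝ => h * ‖v‖ ^ 2) (𝓝[>] 0) (𝓝 (0 * ‖v‖ ^ 2)) :=
        ((continuous_mul_const _).tendsto 0).mono_left nhdsWithin_le_nhds
      rw [zero_mul] at h1
      have h2 : 2 * s * inner ℝ v m ≤ 0 := by
        refine ge_of_tendsto h1 ?_
        filter_upwards [hray v hv', self_mem_nhdsWithin] with h hh hh0
        have hh0 : 0 < h := hh0
        have h3 := hprox _ hh
        rw [add_sub_cancel_left, inner_smul_left, norm_smul, mul_pow, Real.norm_eq_abs,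
          sq_abs] at h3
        simp only [RCLike.conj_to_real] at h3
        refine le_of_mul_le_mul_left ?_ hh0
        nlinarith
      nlinarith
  rwa [hmq] at hprox

lemma neg_mem_normalCone_of_mem_gradientLimits [ProperSpace E] {X : Set E}
    (hX : X ⊆ closure (interior X)) {r : ℝ} (hr : UniqueProjWithin (closedCompl X) r)
    (hr0 : 0 < r) {x v : E} (hx : x ∈ closure X)
    (hv : v ∈ gradientLimits (fun z => Metric.infDist z (closure X)) x) :
    -v ∈ normalCone (closedCompl X) x := by
  by_cases hv0 : v = 0
  · subst hv0
    intro b _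
    simp
  obtain ⟨y, hy, hyx, hyv⟩ := hv
  obtain ⟨N, hN⟩ := eventually_atTop.1 (hyv.eventually_ne hv0)
  have hpos : ∀ n, 0 < Metric.infDist (y (n + N)) (closure X) := fun n =>
    Metric.infDist_nonneg.lt_of_ne fun h => hN (n + N) (Nat.le_add_left N n)
      (gradient_infDist_of_eq_zero h.symm)
  choose p hp hyp using fun n =>
    (isClosed_closure (s := X)).exists_infDist_eq_dist ⟨x, hx⟩ (y (n + N))
  have hprox : ∀ n, IsProxNormal (closedCompl X) (r / 2) (p n)
      (-(gradient (fun z => Metric.infDist z (closure X)) (y (n + N)))) := fun n => by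
    rw [gradient_infDist_of_pos (hy _) (hp n) (hyp n).symm (hpos n)]
    exact isProxNormal_closedCompl_of_closest hX hr (by positivity) (by linarith) (hp n)
      (hyp n).symm (hpos n)
  have hyx' := (tendsto_add_atTop_iff_nat N).2 hyx
  have hpx : Tendsto p atTop (𝓝 x) := by
    have h1 : Tendsto (fun n => dist (p n) (y (n + N))) atTop (𝓝 0) := by
      have := ((Metric.continuous_infDist_pt (closure X)).tendsto x).comp hyx'
      rw [Metric.infDist_zero_of_mem hx] at this
      exact this.congr fun n => by rw [Function.comp_apply, hyp, dist_comm]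
    exact (tendsto_iff_of_dist h1).2 hyx'
  exact (IsProxNormal.of_tendsto hprox hpx
    ((tendsto_add_atTop_iff_nat N).2 hyv).neg).mem_normalCone (by positivity)

/-! ### Separation, descent and the final equality -/

/-- Rescale the nonzero vectors of `K` to the slice `inner ℝ e v = 1`. There the hull is compact, so
`u` separates strictly from it at some level `c`; subtracting `c • e` makes the functional
homogeneous while keeping both inequalities strict. -/
lemma exists_separating_of_notMem_coneHull [FiniteDimensional ℝ E] {K : Set E}
    (hK : IsClosed K) (hK1 : ∀ v ∈ K, v = 0 ∨ ‖v‖ = 1) {e u : E}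
    (he : ∀ v ∈ K, v ≠ 0 → 0 < inner ℝ e v) (heu : 0 < inner ℝ e u)
    (hu : u ∉ coneHull (convexHull ℝ K)) :
    ∃ w : E, 0 < inner ℝ u w ∧ ∀ v ∈ K, v ≠ 0 → inner ℝ v w < 0 := by
  set P : Set E := K ∩ Metric.sphere 0 1 with hP
  have hPc : IsCompact P := (isCompact_sphere (0 : E) 1).inter_left hK
  have hP0 : ∀ v ∈ P, v ≠ 0 := fun v hv h => by simpa [h] using hv.2
  have heP : ∀ v ∈ P, 0 < inner ℝ e v := fun v hv => he v hv.1 (hP0 v hv)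
  set Q : Set E := (fun v => (inner ℝ e v)⁻¹ • v) '' P with hQ
  have hQc : IsCompact (convexHull ℝ Q) := by
    refine isCompact_convexHull (hPc.image_of_continuousOn ?_)
    refine ContinuousOn.smul (ContinuousOn.inv₀ (by fun_prop) fun v hv => (heP v hv).ne')
      continuousOn_id
  have hsub : convexHull ℝ Q ⊆ coneHull (convexHull ℝ K) := by
    refine convexHull_min ?_ (convex_coneHull (convex_convexHull ℝ K))
    rintro _ ⟨v, hv, rfl⟩
    exact ⟨_, inv_nonneg.2 (heP v hv).le, v, subset_convexHull ℝ K hv.1, rfl⟩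
  have hu' : (inner ℝ e u)⁻¹ • u ∉ convexHull ℝ Q := fun h => by
    obtain ⟨t, ht, b, hb, h⟩ := hsub h
    refine hu ⟨inner ℝ e u * t, mul_nonneg heu.le ht, b, hb, ?_⟩
    rw [mul_smul, ← h, smul_smul, mul_inv_cancel₀ heu.ne', one_smul]
  obtain ⟨f, c, hf, hfu⟩ := geometric_hahn_banach_closed_point (convex_convexHull ℝ Q)
    hQc.isClosed hu'
  set g := (InnerProductSpace.toDual ℝ E).symm f with hg
  have hfg : ∀ v, f v = inner ℝ g v := fun v => by
    rw [hg, InnerProductSpace.toDual_symm_apply]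
  have hval : ∀ v : E, 0 < inner ℝ e v →
      inner ℝ v (g - c • e) = inner ℝ e v * (f ((inner ℝ e v)⁻¹ • v) - c) := fun v hv => by
    rw [map_smul, hfg, inner_sub_right, inner_smul_right, real_inner_comm g, real_inner_comm e,
      smul_eq_mul]
    field_simp
  refine ⟨g - c • e, ?_, fun v hv hv0 => ?_⟩
  · rw [hval u heu]
    exact mul_pos heu (sub_pos.2 hfu)
  · have hvP : v ∈ P := ⟨hv, by simpa using (hK1 v hv).resolve_left hv0⟩
    rw [hval v (heP v hvP)]
    exact mul_neg_of_pos_of_neg (heP v hvP)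
      (sub_neg.2 (hf _ (subset_convexHull ℝ Q ⟨v, hvP, rfl⟩)))

/-- Otherwise bad directions at points tending to `x` accumulate at a unit vector of
`gradientLimits` whose inner product with `w` is nonnegative. -/
lemma exists_ball_inner_neg [ProperSpace E] {S : Set E} {x w : E} (hx : Metric.infDist x S = 0)
    (hw : ∀ v ∈ gradientLimits (fun z => Metric.infDist z S) x, v ≠ 0 → inner ℝ v w < 0) :
    ∃ ρ > 0, ∀ y ∈ Metric.ball x ρ, 0 < Metric.infDist y S →
      ∀ p ∈ S, dist y p = Metric.infDist y S → inner ℝ (y - p) w < 0 := by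
  suffices h : ∀ᶠ y in 𝓝 x, 0 < Metric.infDist y S →
      ∀ p ∈ S, dist y p = Metric.infDist y S → inner ℝ (y - p) w < 0 from
    Metric.eventually_nhds_iff_ball.1 h
  by_contra hcon
  obtain ⟨y, hy, hP⟩ := exists_seq_forall_of_frequently (not_eventually.1 hcon)
  push Not at hP
  choose hpos p hp hyp hin using hP
  have hn0 : ∀ n, ‖y n - p n‖ ≠ 0 := fun n => by
    rw [← dist_eq_norm, hyp]; exact (hpos n).ne'
  obtain ⟨q, hq1, φ, hφ, hq⟩ := exists_subseq_tendsto_of_norm_eq_one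
    (u := fun n => ‖y n - p n‖⁻¹ • (y n - p n))
    (fun n => by rw [norm_smul, norm_inv, norm_norm, inv_mul_cancel₀ (hn0 n)])
  have hmem := mem_gradientLimits_infDist hx (hy.comp hφ.tendsto_atTop) (fun n => hp (φ n))
    (fun n => hyp (φ n)) (fun n => hpos (φ n)) hq
  have h1 := hw q hmem (norm_ne_zero_iff.1 (by simp [hq1]))
  have h2 : 0 ≤ inner ℝ q w := by
    refine ge_of_tendsto (hq.inner (tendsto_const_nhds (x := w))) (Eventually.of_forall fun n => ?_)
    simp only [Function.comp_apply, inner_smul_left, RCLike.conj_to_real]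
    exact mul_nonneg (inv_nonneg.2 (norm_nonneg _)) (hin _)
  linarith

lemma add_smul_mem_closedCompl_of_descent {X : Set E} (hX : X ⊆ closure (interior X))
    [ProperSpace E] {x w : E} (hxX : x ∈ closure X)
    (hx : x ∈ closure (interior (closedCompl X)))
    (hw : ∀ v ∈ gradientLimits (fun z => Metric.infDist z (closure X)) x,
      v ≠ 0 → inner ℝ v w < 0) :
    ∃ ε > 0, ∀ t : ℝ, 0 < t → t < ε → x + t • (-w) ∈ closedCompl X := by
  obtain ⟨ρ, hρ, hdesc⟩ := exists_ball_inner_neg (Metric.infDist_zero_of_mem hxX) hw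
  -- With this bound and `z` within `ρ / 2` of `x`, the segment from `z - t • w` to `z` stays in the
  -- ball where descent holds.
  refine ⟨ρ / (2 * (‖w‖ + 1)), by positivity, fun t ht htε => ?_⟩
  have htw : t * ‖w‖ < ρ / 2 := by
    rw [lt_div_iff₀ (by positivity)] at htε
    nlinarith [norm_nonneg w]
  by_contra hcon
  have hcon' : x + t • (-w) ∈ interior X := by rw [← compl_closedCompl]; exact hcon
  obtain ⟨η, hη, hball⟩ := Metric.isOpen_iff.1 isOpen_interior _ hcon'
  obtain ⟨z, hz, hzx⟩ := Metric.mem_closure_iff.1 hx (min η (ρ / 2)) (by positivity)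
  rw [dist_comm] at hzx
  have hzη := hzx.trans_le (min_le_left _ _)
  have hzρ := hzx.trans_le (min_le_right _ _)
  have hz0 : z + t • (-w) ∈ X := interior_subset (hball (by
    rw [Metric.mem_ball, dist_add_right]; exact hzη))
  have h0 : Metric.infDist (z + t • (-w) + t • w) (closure X) = 0 := by
    refine infDist_add_smul_eq_zero_of_descent ht.le
      (Metric.infDist_zero_of_mem (subset_closure hz0)) fun τ hτ hpos => ?_
    obtain ⟨p, hp, hyp⟩ := (isClosed_closure (s := X)).exists_infDist_eq_dist ⟨x, hxX⟩
      (z + t • (-w) + τ • w)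
    refine ⟨p, hp, hyp.symm, hdesc _ ?_ hpos p hp hyp.symm⟩
    have h1 : z + t • (-w) + τ • w - x = (z - x) - (t - τ) • w := by module
    rw [Metric.mem_ball, dist_eq_norm, h1]
    refine (norm_sub_le _ _).trans_lt ?_
    rw [norm_smul, Real.norm_eq_abs, abs_of_nonneg (sub_nonneg.2 hτ.2), ← dist_eq_norm]
    nlinarith [norm_nonneg w, hτ.1]
  rw [smul_neg, neg_add_cancel_right] at h0
  have hzX : z ∈ closure X := by
    rw [← closure_closure, (isClosed_closure.mem_iff_infDist_zero ⟨x, subset_closure hxX⟩)]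
    rwa [closure_closure]
  have hzint : z ∈ closure (interior X) := closure_minimal hX isClosed_closure hzX
  obtain ⟨b, hb1, hb2⟩ := mem_closure_iff.1 hzint _ isOpen_interior hz
  have : b ∈ (closedCompl X)ᶜ := by rw [compl_closedCompl]; exact hb2
  exact this (interior_subset hb1)

theorem normalConeOfCompl_eq_coneHull_clarkeGradient [FiniteDimensional ℝ E] {X : Set E}
    (hX : X ⊆ closure (interior X)) (hreach : 0 < reach (closedCompl X))
    (hfull : FullyDimensional (closedCompl X)) {x : E} (hx : x ∈ frontier (closedCompl X)) :
    normalConeOfCompl X x = coneHull (clarkeGradient (fun y => Metric.infDist y X) x) := by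
  have hA := isClosed_closedCompl X
  have hxA : x ∈ closedCompl X := hA.frontier_subset hx
  have hxint : x ∈ closure (interior X) := by
    rw [frontier_eq_closure_inter_closure, compl_closedCompl] at hx
    exact hx.2
  have hxX : x ∈ closure X := closure_mono interior_subset hxint
  obtain ⟨r, hr0, hr⟩ := exists_uniqueProjWithin_of_reach_pos ⟨x, hxA⟩ hreach
  obtain ⟨e, he⟩ := exists_inner_neg_of_span_eq_top
    (Submodule.eq_top_of_finrank_eq (hfull x hx))
  have hfun : (fun y => Metric.infDist y X) = fun y => Metric.infDist y (closure X) :=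
    funext fun y => Metric.infDist_closure.symm
  set K := gradientLimits (fun y => Metric.infDist y (closure X)) x with hK
  have hclarke : clarkeGradient (fun y => Metric.infDist y X) x = convexHull ℝ K := by
    rw [hfun]; rfl
  rw [hclarke]
  have hKN : ∀ v ∈ K, -v ∈ normalCone (closedCompl X) x := fun v hv =>
    neg_mem_normalCone_of_mem_gradientLimits hX hr hr0 hxX hv
  refine Set.Subset.antisymm (fun u hu => ?_) ?_
  · have hu : -u ∈ normalCone (closedCompl X) x := hu
    by_contra hcon
    -- The cone generated by the empty set is empty, so the case `u = 0` needs an element of `K`.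
    have h0K : (0 : E) ∈ K := zero_mem_gradientLimits_infDist
      (closure_mono (interior_mono subset_closure) hxint)
    have hu0 : u ≠ 0 := fun h => hcon
      ⟨0, le_rfl, 0, subset_convexHull ℝ K h0K, by rw [h, smul_zero]⟩
    have hpos : ∀ v : E, -v ∈ normalCone (closedCompl X) x → v ≠ 0 → 0 < inner ℝ e v := by
      intro v hv hv0
      have := he _ hv (neg_ne_zero.2 hv0)
      rw [inner_neg_left, real_inner_comm] at this
      linarith
    obtain ⟨w, huw, hw⟩ := exists_separating_of_notMem_coneHull (isClosed_gradientLimits _ x)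
      (fun v hv => norm_of_mem_gradientLimits_infDist isClosed_closure ⟨x, hxX⟩ hv)
      (fun v hv => hpos v (hKN v hv)) (hpos u hu hu0) hcon
    obtain ⟨ε, hε, hA'⟩ := add_smul_mem_closedCompl_of_descent hX hxX
      (hr.mem_closure_interior hA hr0 hxA he) hw
    have hw0 : w ≠ 0 := fun h => by simp [h] at huw
    have := hu _ (mem_tangentCone_of_forall_add_smul_mem hε (neg_ne_zero.2 hw0) hA')
    rw [inner_neg_neg] at this
    linarith
  · rintro _ ⟨t, ht, b, hb, rfl⟩
    have hsub : convexHull ℝ K ⊆ -normalCone (closedCompl X) x :=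
      convexHull_min hKN (convex_polarCone _).neg
    have := smul_mem_polarCone ht (hsub hb)
    rw [smul_neg] at this
    exact this

end NormalClarke

end

theorem mainTheorem7 (d : ℕ) (X : Set (EuclideanSpace ℝ (Fin d)))
    (hX : X ⊆ closure (interior X))
    (hreach : 0 < NormalClarke.reach (NormalClarke.closedCompl X))
    (hfull : NormalClarke.FullyDimensional (NormalClarke.closedCompl X))
    (x : EuclideanSpace ℝ (Fin d)) (hx : x ∈ frontier (NormalClarke.closedCompl X)) :
    NormalClarke.normalConeOfCompl X x =
      NormalClarke.coneHull
        (NormalClarke.clarkeGradient (fun y => Metric.infDist y X) x) := by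
  exact NormalClarke.normalConeOfCompl_eq_coneHull_clarkeGradient hX hreach hfull hx
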